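/- Let $k$ be a positive integer and let $\Lambda$ be a row-finite $k$-graph with no sources: a countable category with objects (vertices) $\Lambda^0$, morphisms (paths) $\Lambda$, range and source maps $r,s$, and a degree functor $d:\Lambda\to\mathbb N^k$ such that whenever $d(\lambda)=m+n$ there are unique $\mu,\nu\in\Lambda$ with $s(\mu)=r(\nu)$, $d(\mu)=m$, $d(\nu)=n$ and $\lambda=\mu\nu$, and such that $v\Lambda^n=\{\lambda\in\Lambda : r(\lambda)=v,\ d(\lambda)=n\}$ is finite and nonempty for all $v\in\Lambda^0$, $n\in\mathbb N^k$. Let $R$ be a commutative ring with $1\neq 0$. Let $\mathrm{KP}_R(\Lambda)$ be the Kumjian–Pask algebra, i.e. the universal (not necessarily unital) associative $R$-algebra generated by elements $p_v$ ($v\in\Lambda^0$) and $s_\lambda,s_{\lambda^*}$ ($\lambda\in\Lambda$, $d(\lambda)\ne0$) subject to: (KP1) the $p_v$ are mutually orthogonal idempotents; (KP2) $s_\lambda s_\mu=s_{\lambda\mu}$ and $s_{\mu^*}s_{\lambda^*}=s_{(\lambda\mu)^*}$ if $s(\lambda)=r(\mu)$, $p_{r(\lambda)}s_\lambda=s_\lambda=s_\lambda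 p_{s(\lambda)}$ and $p_{s(\lambda)}s_{\lambda^*}=s_{\lambda^*}=s_{\lambda^*}p_{r(\lambda)}$; (KP3) $s_{\lambda^*}s_\mu=\delta_{\lambda,\mu}\,p_{s(\lambda)}$ if $d(\lambda)=d(\mu)$; (KP4) $p_v=\sum_{\lambda\in v\Lambda^n}s_\lambda s_{\lambda^*}$ for all $v\in\Lambda^0$ and $n\neq0$. Put $s_v=s_{v^*}=p_v$ for vertices $v$. Let $a\mapsto a^*$ be the $R$-linear involution of $\mathrm{KP}_R(\Lambda)$ with $(ab)^*=b^*a^*$, $p_v^*=p_v$ and $(s_\lambda)^*=s_{\lambda^*}$; an element $a$ is normal if $aa^*=a^*a$. Let $\mathcal D$ be the $R$-subalgebra of $\mathrm{KP}_R(\Lambda)$ generated by $\{s_\mu s_{\mu^*}:\mu\in\Lambda\}$. Let $\Omega_k$ be the category with objects $\mathbb N^k$ and one morphism $(p,q)$, with range $p$, source $q$ and degree $q-p$, for each pair $p\le q$. Let $\Lambda^\infty$ be the set of infinite paths, i.e. degree-preserving functors $x:\Omega_k\to\Lambda$, and let $r(x)=x(0,0)$ and $v\Lambda^\infty=\{x\in\Lambda^\infty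 : r(x)=v\}$. For $\alpha\in\Lambda$ and $x\in s(\alpha)\Lambda^\infty$ let $\alpha x$ be the unique infinite path with $(\alpha x)(0,n)=\alpha\,x(0,n-d(\alpha))$ for all $n\ge d(\alpha)$. Then for all $\alpha,\beta\in\Lambda$ with $s(\alpha)=s(\beta)$ the following are equivalent: 1. $s_{\alpha\gamma}s_{(\alpha\gamma)^*}=s_{\beta\gamma}s_{(\beta\gamma)^*}$ for all $\gamma\in\Lambda$ with $r(\gamma)=s(\alpha)$; 2. $s_\alpha s_{\beta^*}$ is normal and commutes with every element of $\mathcal D$; 3. $\alpha\gamma=\beta\gamma$ for every $\gamma\in s(\alpha)\Lambda^\infty$. -/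

import Mathlib

open CategoryTheory

universe w u

/-- A morphism of a category `C` together with its source and its target, so that the morphisms of
`C` form one type. -/
structure Mor (C : Type u) [Category.{w} C] where
  source : C
  target : C
  hom : source ⟶ target

namespace Mor

variable {C : Type u} [Category.{w} C]

/-- The identity morphism at an object. -/
def id (v : C) : Mor C := ⟨v, v, 𝟙 v⟩

/-- The composite `a b` (first `b`, then `a`) of morphisms with `source a = target b`. -/
def comp (a b : Mor C) (h : a.source = b.target) : Mor C :=
  ⟨b.source, a.target, b.hom ≫ eqToHom h.symm ≫ a.hom⟩

theorem id_comp (a : Mor C) : (id a.target).comp a rfl = a := by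
  obtain ⟨v, w, f⟩ := a
  change (⟨v, w, f ≫ 𝟙 w ≫ 𝟙 w⟩ : Mor C) = _
  simp

theorem comp_id (a : Mor C) : a.comp (id a.source) rfl = a := by
  cases a; simp [comp, id]

theorem comp_assoc (a b c : Mor C) (h : a.source = b.target) (h' : b.source = c.target) :
    (a.comp b h).comp c h' = a.comp (b.comp c h') h := by
  cases a; cases b; cases c; simp [comp]

theorem comp_congr {a a' b b' : Mor C} (ha : a = a') (hb : b = b') (h : a.source = b.target) :
    a.comp b h = a'.comp b' (by rw [← ha, ← hb]; exact h) := by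
  subst ha; subst hb; rfl

theorem mk_eqToHom (a : Mor C) {v w : C} (hv : v = a.source) (hw : a.target = w) :
    (⟨v, w, eqToHom hv ≫ a.hom ≫ eqToHom hw⟩ : Mor C) = a := by
  subst hv; subst hw; simp

theorem hom_eq_of_mk_eq {v w : C} {f g : v ⟶ w} (h : (⟨v, w, f⟩ : Mor C) = ⟨v, w, g⟩) : f = g := by
  simpa using h

end Mor

/-- A `k`-graph: a countable category with a degree functor `deg` to the monoid `ℕ^k` (a category
with one object) that has the unique factorization property. -/
structure KGraph (k : ℕ) where
  /-- the objects, called vertices -/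
  Vertex : Type u
  [cat : Category.{w} Vertex]
  countable : Countable (Mor Vertex)
  deg : Mor Vertex → (Fin k → ℕ)
  deg_id : ∀ v, deg (Mor.id v) = 0
  deg_comp : ∀ a b (h : a.source = b.target), deg (a.comp b h) = deg a + deg b
  factorization : ∀ (l : Mor Vertex) (m n : Fin k → ℕ), deg l = m + n →
    ∃! p : Mor Vertex × Mor Vertex, deg p.1 = m ∧ deg p.2 = n ∧
      ∃ h : p.1.source = p.2.target, l = p.1.comp p.2 h

attribute [instance] KGraph.cat

namespace KGraph

variable {k : ℕ} (Λ : KGraph.{w, u} k)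

/-- The paths of `Λ` are its morphisms. -/
abbrev Path := Mor Λ.Vertex

/-- The set `v Λ^n` of paths of degree `n` with range `v`. -/
def pathsTo (v : Λ.Vertex) (n : Fin k → ℕ) : Set Λ.Path := {l | l.target = v ∧ Λ.deg l = n}

/-- `Λ` is row-finite: every `v Λ^n` is finite. -/
class RowFinite : Prop where
  finite : ∀ v n, (Λ.pathsTo v n).Finite

/-- `Λ` has no sources: no `v Λ^n` is empty. -/
class NoSources : Prop where
  nonempty : ∀ v n, (Λ.pathsTo v n).Nonempty

noncomputable instance [Λ.RowFinite] (v : Λ.Vertex) (n : Fin k → ℕ) :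
    Fintype (Λ.pathsTo v n) :=
  (RowFinite.finite v n).fintype

variable {Λ}

theorem comp_inj {a b a' b' : Λ.Path} (h : a.source = b.target) (h' : a'.source = b'.target)
    (hd : Λ.deg a = Λ.deg a') (e : a.comp b h = a'.comp b' h') : a = a' ∧ b = b' := by
  have hb : Λ.deg b = Λ.deg b' := by
    have := congrArg Λ.deg e
    rw [Λ.deg_comp, Λ.deg_comp, hd] at this
    exact add_left_cancel this
  have := (Λ.factorization (a.comp b h) _ _ (Λ.deg_comp a b h)).unique
    (y₁ := (a, b)) (y₂ := (a', b')) ⟨rfl, rfl, h, rfl⟩ ⟨hd.symm, hb.symm, h', e⟩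
  simpa using this

theorem eq_id_of_deg_eq_zero {a : Λ.Path} (h : Λ.deg a = 0) : a = Mor.id a.target :=
  (comp_inj (a := a) (b := Mor.id a.source) (a' := Mor.id a.target) (b' := a) rfl rfl
    (by rw [h, Λ.deg_id]) (by rw [Mor.comp_id, Mor.id_comp])).1

variable (Λ)

/-- The objects `ℕ^k` of the category `Ω_k`. -/
def _root_.Omega (k : ℕ) : Type := Fin k → ℕ

/-- The category `Ω_k`: there is exactly one morphism `(p, q)`, with source `q` and range `p`,
whenever `p ≤ q`. Its degree is `q - p`. -/
instance _root_.Omega.category (k : ℕ) : Category.{0} (Omega k) where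
  Hom q p := PLift (∀ i, p i ≤ q i)
  id _ := ⟨fun _ => le_rfl⟩
  comp f g := ⟨fun i => (g.down i).trans (f.down i)⟩

/-- The object `p` of `Ω_k`. -/
def _root_.Omega.of (p : Fin k → ℕ) : Omega k := p

/-- The morphism `(p, q)` of `Ω_k`. -/
def _root_.Omega.mor (p q : Fin k → ℕ) (h : p ≤ q) : Omega.of q ⟶ Omega.of p := ⟨h⟩

/-- An infinite path: a degree-preserving functor from `Ω_k` to `Λ`. -/
structure InfPath where
  toFunctor : Omega k ⥤ Λ.Vertex
  deg_map : ∀ (p q : Fin k → ℕ) (h : p ≤ q),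
    Λ.deg ⟨_, _, toFunctor.map (Omega.mor p q h)⟩ = q - p

variable {Λ}

namespace InfPath

/-- The path `x(p, q)`, for `p ≤ q`. -/
def seg (x : Λ.InfPath) (p q : Fin k → ℕ) (h : p ≤ q) : Λ.Path :=
  ⟨x.toFunctor.obj (.of q), x.toFunctor.obj (.of p), x.toFunctor.map (Omega.mor p q h)⟩

/-- The range `x(0, 0)` of an infinite path. -/
def range (x : Λ.InfPath) : Λ.Vertex := x.toFunctor.obj (.of 0)

theorem range_eq_target (x : Λ.InfPath) (n : Fin k → ℕ) :
    x.range = (x.seg 0 n zero_le).target := rfl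

theorem source_eq_target (x : Λ.InfPath) (p q r : Fin k → ℕ) (h : p ≤ q) (h' : q ≤ r) :
    (x.seg p q h).source = (x.seg q r h').target := rfl

theorem deg_seg (x : Λ.InfPath) (p q : Fin k → ℕ) (h : p ≤ q) : Λ.deg (x.seg p q h) = q - p :=
  x.deg_map p q h

theorem deg_seg_zero (x : Λ.InfPath) (q : Fin k → ℕ) : Λ.deg (x.seg 0 q zero_le) = q :=
  (x.deg_map 0 q zero_le).trans (tsub_zero q)

theorem seg_comp (x : Λ.InfPath) (p q r : Fin k → ℕ) (h : p ≤ q) (h' : q ≤ r) :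
    (x.seg p q h).comp (x.seg q r h') (x.source_eq_target p q r h h') = x.seg p r (h.trans h') := by
  change (⟨_, _, x.toFunctor.map (Omega.mor q r h') ≫ 𝟙 _ ≫
    x.toFunctor.map (Omega.mor p q h)⟩ : Λ.Path) = _
  rw [Category.id_comp, ← Functor.map_comp]
  rfl

theorem ext_seg {x y : Λ.InfPath} (h : ∀ p q hpq, x.seg p q hpq = y.seg p q hpq) : x = y := by
  obtain ⟨x, hx⟩ := x
  obtain ⟨y, hy⟩ := y
  have : x = y := by
    refine CategoryTheory.Functor.hext (fun p => ?_) (fun p q f => ?_)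
    · exact congrArg Mor.source (h p p le_rfl)
    · have := h q p f.down
      simp only [seg, Mor.mk.injEq] at this
      exact this.2.2
  subst this
  rfl

theorem ext_seg_zero {x y : Λ.InfPath} (h : ∀ q, x.seg 0 q zero_le = y.seg 0 q zero_le) :
    x = y := by
  refine ext_seg fun p q hpq => ?_
  have hx := x.seg_comp 0 p q zero_le hpq
  have hy := y.seg_comp 0 p q zero_le hpq
  rw [← h q, ← hx] at hy
  exact (comp_inj _ _ (by rw [h p]) hy).2.symm

/-- A compatible family of finite paths comes from an infinite path. -/
theorem exists_of_compatible (y : (Fin k → ℕ) → Λ.Path) (hd : ∀ n, Λ.deg (y n) = n)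
    (hy : ∀ p q, p ≤ q → ∃ b, ∃ h : (y p).source = b.target, y q = (y p).comp b h) :
    ∃ x : Λ.InfPath, ∀ n, x.seg 0 n zero_le = y n := by
  choose b hb e using hy
  have hs : ∀ p q h, (y q).source = (b p q h).source := fun p q h => by
    conv_lhs => rw [e p q h]
    rfl
  have hid : ∀ p, b p p le_rfl = Mor.id (y p).source := fun p =>
    (comp_inj (hb p p le_rfl) rfl rfl ((e p p le_rfl).symm.trans (Mor.comp_id _).symm)).2
  have hcomp : ∀ p q r (h : p ≤ q) (h' : q ≤ r), b p r (h.trans h') =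
      (b p q h).comp (b q r h') ((hs p q h).symm.trans (hb q r h')) := fun p q r h h' => by
    refine (comp_inj (b' := (b p q h).comp (b q r h') ((hs p q h).symm.trans (hb q r h')))
      (hb p r (h.trans h')) (hb p q h) rfl ?_).2
    rw [← e p r, e q r h', ← Mor.comp_assoc _ _ _ _ ((hs p q h).symm.trans (hb q r h'))]
    exact Mor.comp_congr (e p q h) rfl _
  let F : Omega k ⥤ Λ.Vertex :=
    { obj := fun p => (y p).source
      map := fun {p q} f => eqToHom (hs q p f.down) ≫ (b q p f.down).hom ≫
        eqToHom (hb q p f.down).symm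
      map_id := fun p => Mor.hom_eq_of_mk_eq ((Mor.mk_eqToHom _ _ _).trans (hid p))
      map_comp := fun {p q r} f g => by
        refine Mor.hom_eq_of_mk_eq ((Mor.mk_eqToHom _ _ _).trans
          ((hcomp r q p g.down f.down).trans ?_))
        have h1 := (Mor.mk_eqToHom (b q p f.down) (hs _ _ _) (hb _ _ _).symm).symm
        have h2 := (Mor.mk_eqToHom (b r q g.down) (hs _ _ _) (hb _ _ _).symm).symm
        refine (Mor.comp_congr h2 h1 _).trans ?_
        simp [Mor.comp] }
  have hF : ∀ p q h, (⟨_, _, F.map (Omega.mor p q h)⟩ : Λ.Path) = b p q h :=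
    fun p q h => Mor.mk_eqToHom _ _ _
  refine ⟨⟨F, fun p q h => ?_⟩, fun n => ?_⟩
  · rw [hF p q h]
    have := congrArg Λ.deg (e p q h)
    rw [Λ.deg_comp, hd, hd] at this
    exact eq_tsub_of_add_eq ((add_comm _ _).trans this.symm)
  · refine (hF 0 n zero_le).trans ?_
    rw [e 0 n zero_le]
    have h0 := eq_id_of_deg_eq_zero (hd 0)
    have h1 : (y 0).target = (b 0 n zero_le).target := by
      rw [← hb 0 n zero_le]
      conv_rhs => rw [h0]
      rfl
    refine (Mor.id_comp _).symm.trans (Mor.comp_congr ?_ rfl _)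
    rw [h0, ← h1]

theorem existsUnique_prepend (a : Λ.Path) (x : Λ.InfPath) (h : a.source = x.range) :
    ∃! y : Λ.InfPath, ∀ n (_ : Λ.deg a ≤ n), y.seg 0 n zero_le =
      a.comp (x.seg 0 (n - Λ.deg a) zero_le) (h.trans (x.range_eq_target _)) := by
  have key : ∀ n, ∃ c : Λ.Path × Λ.Path, Λ.deg c.1 = n ∧ Λ.deg c.2 = Λ.deg a ∧
      ∃ h' : c.1.source = c.2.target,
        a.comp (x.seg 0 n zero_le) (h.trans (x.range_eq_target n)) = c.1.comp c.2 h' := fun n =>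
    (Λ.factorization (a.comp (x.seg 0 n zero_le) (h.trans (x.range_eq_target n))) n (Λ.deg a)
      (by rw [Λ.deg_comp, deg_seg_zero, add_comm])).exists
  choose c hc1 hc2 hc3 hc using key
  have split : ∀ p q (hpq : p ≤ q), a.comp (x.seg 0 q zero_le) (h.trans (x.range_eq_target q)) =
      (a.comp (x.seg 0 p zero_le) (h.trans (x.range_eq_target p))).comp (x.seg p q hpq)
        (x.source_eq_target 0 p q zero_le hpq) := fun p q hpq => by
    rw [Mor.comp_assoc _ _ _ _ (x.source_eq_target 0 p q zero_le hpq)]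
    exact Mor.comp_congr rfl (x.seg_comp 0 p q zero_le hpq).symm _
  have pre : ∀ p q (u v : Λ.Path) (hu : u.source = v.target), p ≤ q → Λ.deg u = p →
      a.comp (x.seg 0 q zero_le) (h.trans (x.range_eq_target q)) = u.comp v hu →
        u = (c p).1 := by
    intro p q u v hu hpq hdu e
    have hs : (c p).2.source = (x.seg p q hpq).target := (congrArg Mor.source (hc p)).symm
    have e' := (split p q hpq).trans (Mor.comp_congr (hc p) rfl _)
    rw [Mor.comp_assoc _ _ _ (hc3 p) hs] at e'
    exact (comp_inj _ _ (by rw [hc1, hdu]) (e'.symm.trans e)).1.symm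
  obtain ⟨y, hy⟩ := exists_of_compatible (fun n => (c n).1) hc1 (fun p q hpq => by
    obtain ⟨⟨u, v⟩, ⟨hu, hv, hs, huv⟩, -⟩ := Λ.factorization (c q).1 p (q - p)
      (by rw [hc1, add_tsub_cancel_of_le hpq])
    have hs' : v.source = (c q).2.target := by
      rw [← hc3 q, huv]; rfl
    have : u = (c p).1 := by
      refine pre p q u (v.comp (c q).2 hs') hs hpq hu ?_
      rw [hc q, ← Mor.comp_assoc _ _ _ hs]
      exact Mor.comp_congr huv rfl _
    subst this
    exact ⟨v, hs, huv⟩)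
  refine ⟨y, fun n hn => ?_, fun z hz => ext_seg_zero fun n => ?_⟩
  · rw [hy]
    refine (pre n n (a.comp (x.seg 0 (n - Λ.deg a) zero_le) (h.trans (x.range_eq_target _)))
      (x.seg (n - Λ.deg a) n tsub_le_self)
      (x.source_eq_target 0 _ n zero_le tsub_le_self) le_rfl ?_ (split (n - Λ.deg a) n tsub_le_self)).symm
    rw [Λ.deg_comp, deg_seg_zero, add_tsub_cancel_of_le hn]
  · rw [hy]
    refine pre n n _ (z.seg n (n + Λ.deg a) le_self_add)
      (z.source_eq_target 0 n _ zero_le le_self_add) le_rfl (z.deg_seg_zero n) ?_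
    rw [z.seg_comp, hz _ le_add_self]
    have hn : n + Λ.deg a - Λ.deg a = n := add_tsub_cancel_right _ _
    congr 2; exact hn.symm

/-- The infinite path `a x`, for a path `a` and an infinite path `x` with `source a = range x`: the
unique infinite path with `(a x)(0, n) = a (x(0, n - deg a))` for all `n ≥ deg a`. -/
noncomputable def prepend (a : Λ.Path) (x : Λ.InfPath) (h : a.source = x.range) : Λ.InfPath :=
  (existsUnique_prepend a x h).choose

theorem prepend_spec (a : Λ.Path) (x : Λ.InfPath) (h : a.source = x.range) (n : Fin k → ℕ)
    (hn : Λ.deg a ≤ n) : (prepend a x h).seg 0 n zero_le =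
      a.comp (x.seg 0 (n - Λ.deg a) zero_le) (h.trans (x.range_eq_target _)) :=
  (existsUnique_prepend a x h).choose_spec.1 n hn

end InfPath

variable (Λ)

/-- The paths of nonzero degree. -/
abbrev NZPath := {l : Λ.Path // Λ.deg l ≠ 0}

variable {Λ}

/-- The composite of two paths of nonzero degree. -/
def NZPath.comp (a b : Λ.NZPath) (h : a.1.source = b.1.target) : Λ.NZPath :=
  ⟨a.1.comp b.1 h, fun e => a.2 (by
    rw [Λ.deg_comp] at e
    exact (add_eq_zero.mp e).1)⟩

/-- A path of degree `n ≠ 0` with range `v`, as a path of nonzero degree. -/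
def NZPath.ofPathsTo {v : Λ.Vertex} {n : Fin k → ℕ} (hn : n ≠ 0) (l : Λ.pathsTo v n) : Λ.NZPath :=
  ⟨l.1, fun e => hn (l.2.2.symm.trans e)⟩

/-- A Kumjian-Pask `Λ`-family in a (not necessarily unital) algebra: `P v` for the vertices, `S l`
for the paths and `T l` (usually written `S_{l*}`) for the ghost paths of nonzero degree. -/
structure IsKumjianPaskFamily [Λ.RowFinite] {A : Type*} [NonUnitalSemiring A]
    (P : Λ.Vertex → A) (S T : Λ.NZPath → A) : Prop where
  vertex_mul_self : ∀ v, P v * P v = P v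
  vertex_mul_vertex : ∀ v w, v ≠ w → P v * P w = 0
  path_mul_path : ∀ (a b : Λ.NZPath) (h : a.1.source = b.1.target), S a * S b = S (a.comp b h)
  ghost_mul_ghost : ∀ (a b : Λ.NZPath) (h : a.1.source = b.1.target), T b * T a = T (a.comp b h)
  range_mul_path : ∀ a : Λ.NZPath, P a.1.target * S a = S a
  path_mul_source : ∀ a : Λ.NZPath, S a * P a.1.source = S a
  source_mul_ghost : ∀ a : Λ.NZPath, P a.1.source * T a = T a
  ghost_mul_range : ∀ a : Λ.NZPath, T a * P a.1.target = T a
  ghost_mul_path_self : ∀ a : Λ.NZPath, T a * S a = P a.1.source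
  ghost_mul_path_of_ne : ∀ a b : Λ.NZPath, Λ.deg a.1 = Λ.deg b.1 → a ≠ b → T a * S b = 0
  vertex_eq_sum : ∀ (v : Λ.Vertex) (n : Fin k → ℕ) (hn : n ≠ 0),
    P v = ∑ l : Λ.pathsTo v n, S (NZPath.ofPathsTo hn l) * T (NZPath.ofPathsTo hn l)

variable (Λ) in
/-- The generators of the Kumjian-Pask algebra. -/
inductive Gen
  | vertex (v : Λ.Vertex) : Gen
  | path (a : Λ.NZPath) : Gen
  | ghost (a : Λ.NZPath) : Gen

section KP

variable (R : Type*) [CommRing R]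

variable (Λ) in
/-- The free associative `R`-algebra without unit on the generators. -/
abbrev FreeAlg := MonoidAlgebra R (FreeSemigroup Λ.Gen)

/-- A generator as an element of the free algebra. -/
noncomputable def FreeAlg.of (g : Λ.Gen) : Λ.FreeAlg R :=
  MonoidAlgebra.ofMagma R _ (FreeSemigroup.of g)

variable [Λ.RowFinite]

open FreeAlg Gen in
/-- The defining relations of the Kumjian-Pask algebra, closed under the operations of a (not
necessarily unital) `R`-algebra. -/
inductive KPRel : Λ.FreeAlg R → Λ.FreeAlg R → Prop
  | vertex_mul_self (v) : KPRel (of R (vertex v) * of R (vertex v)) (of R (vertex v))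
  | vertex_mul_vertex (v w) (h : v ≠ w) : KPRel (of R (vertex v) * of R (vertex w)) 0
  | path_mul_path (a b : Λ.NZPath) (h : a.1.source = b.1.target) :
      KPRel (of R (path a) * of R (path b)) (of R (path (a.comp b h)))
  | ghost_mul_ghost (a b : Λ.NZPath) (h : a.1.source = b.1.target) :
      KPRel (of R (ghost b) * of R (ghost a)) (of R (ghost (a.comp b h)))
  | range_mul_path (a : Λ.NZPath) :
      KPRel (of R (vertex a.1.target) * of R (path a)) (of R (path a))
  | path_mul_source (a : Λ.NZPath) :
      KPRel (of R (path a) * of R (vertex a.1.source)) (of R (path a))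
  | source_mul_ghost (a : Λ.NZPath) :
      KPRel (of R (vertex a.1.source) * of R (ghost a)) (of R (ghost a))
  | ghost_mul_range (a : Λ.NZPath) :
      KPRel (of R (ghost a) * of R (vertex a.1.target)) (of R (ghost a))
  | ghost_mul_path_self (a : Λ.NZPath) :
      KPRel (of R (ghost a) * of R (path a)) (of R (vertex a.1.source))
  | ghost_mul_path_of_ne (a b : Λ.NZPath) (hd : Λ.deg a.1 = Λ.deg b.1) (h : a ≠ b) :
      KPRel (of R (ghost a) * of R (path b)) 0
  | vertex_eq_sum (v : Λ.Vertex) (n : Fin k → ℕ) (hn : n ≠ 0) :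
      KPRel (of R (vertex v)) (∑ l : Λ.pathsTo v n,
        of R (path (NZPath.ofPathsTo hn l)) * of R (ghost (NZPath.ofPathsTo hn l)))
  | smul (t : R) {a b : Λ.FreeAlg R} : KPRel a b → KPRel (t • a) (t • b)
  | add_right {a b : Λ.FreeAlg R} (c : Λ.FreeAlg R) : KPRel a b → KPRel (a + c) (b + c)
  | mul_left (a : Λ.FreeAlg R) {b c : Λ.FreeAlg R} : KPRel b c → KPRel (a * b) (a * c)
  | mul_right {a b : Λ.FreeAlg R} (c : Λ.FreeAlg R) : KPRel a b → KPRel (a * c) (b * c)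

variable {R}

theorem KPRel.add_left (a : Λ.FreeAlg R) {b c : Λ.FreeAlg R} (h : KPRel R b c) :
    KPRel R (a + b) (a + c) := by
  rw [add_comm _ b, add_comm _ c]; exact h.add_right _

theorem KPRel.neg {a b : Λ.FreeAlg R} (h : KPRel R a b) : KPRel R (-a) (-b) := by
  simpa only [neg_one_smul] using h.smul (-1)

theorem KPRel.sub_left (a : Λ.FreeAlg R) {b c : Λ.FreeAlg R} (h : KPRel R b c) :
    KPRel R (a - b) (a - c) := by
  simpa only [sub_eq_add_neg] using h.neg.add_left a

theorem KPRel.sub_right {a b : Λ.FreeAlg R} (c : Λ.FreeAlg R) (h : KPRel R a b) :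
    KPRel R (a - c) (b - c) := by
  simpa only [sub_eq_add_neg] using h.add_right (-c)

variable (Λ R)

/-- The Kumjian-Pask algebra `KP_R(Λ)`: the (not necessarily unital) associative `R`-algebra given
by the generators and the relations of a Kumjian-Pask family. Its universal property is
`KP.existsUnique_lift` below. -/
def KP := Quot (KPRel (Λ := Λ) R)

namespace KP

variable {Λ R}

noncomputable instance : Zero (Λ.KP R) where zero := Quot.mk _ 0

noncomputable instance : Add (Λ.KP R) where
  add := Quot.map₂ (· + ·) (fun _ _ _ => KPRel.add_left _) fun _ _ _ => KPRel.add_right _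

noncomputable instance : Neg (Λ.KP R) where neg := Quot.map Neg.neg fun _ _ => KPRel.neg

noncomputable instance : Sub (Λ.KP R) where
  sub := Quot.map₂ Sub.sub (fun _ _ _ => KPRel.sub_left _) fun _ _ _ => KPRel.sub_right _

noncomputable instance : Mul (Λ.KP R) where
  mul := Quot.map₂ (· * ·) (fun _ _ _ => KPRel.mul_left _) fun _ _ _ => KPRel.mul_right _

noncomputable instance : SMul R (Λ.KP R) where smul t := Quot.map (t • ·) fun _ _ => KPRel.smul t

noncomputable instance : SMul ℕ (Λ.KP R) where
  smul n := Quot.map (n • ·) fun a b h => by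
    simpa only [Nat.cast_smul_eq_nsmul] using h.smul (n : R)

noncomputable instance : SMul ℤ (Λ.KP R) where
  smul n := Quot.map (n • ·) fun a b h => by
    simpa only [Int.cast_smul_eq_zsmul] using h.smul (n : R)

noncomputable instance : NonUnitalRing (Λ.KP R) :=
  Function.Surjective.nonUnitalRing (Quot.mk (KPRel R)) Quot.mk_surjective rfl (fun _ _ => rfl)
    (fun _ _ => rfl) (fun _ => rfl) (fun _ _ => rfl) (fun _ _ => rfl) (fun _ _ => rfl)

noncomputable instance : Module R (Λ.KP R) :=
  Function.Surjective.module R ⟨⟨Quot.mk (KPRel R), rfl⟩, fun _ _ => rfl⟩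
    Quot.mk_surjective (fun _ _ => rfl)

instance : IsScalarTower R (Λ.KP R) (Λ.KP R) where
  smul_assoc := by
    rintro t ⟨a⟩ ⟨b⟩
    exact congrArg (Quot.mk (KPRel R)) (smul_mul_assoc t a b)

instance : SMulCommClass R (Λ.KP R) (Λ.KP R) where
  smul_comm := by
    rintro t ⟨a⟩ ⟨b⟩
    exact congrArg (Quot.mk (KPRel R)) (mul_smul_comm t a b).symm

/-- The quotient map. -/
noncomputable def mk : Λ.FreeAlg R →ₙₐ[R] Λ.KP R where
  toFun := Quot.mk (KPRel R)
  map_smul' _ _ := rfl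
  map_zero' := rfl
  map_add' _ _ := rfl
  map_mul' _ _ := rfl

variable (R)

/-- The generator `p_v`. -/
noncomputable def p (v : Λ.Vertex) : Λ.KP R := mk (FreeAlg.of R (.vertex v))

/-- The generator `s_a`, for a path of nonzero degree. -/
noncomputable def s (a : Λ.NZPath) : Λ.KP R := mk (FreeAlg.of R (.path a))

/-- The generator `s_{a*}`, for a path of nonzero degree. -/
noncomputable def t (a : Λ.NZPath) : Λ.KP R := mk (FreeAlg.of R (.ghost a))

variable (Λ) in
theorem isKumjianPaskFamily : IsKumjianPaskFamily (p (Λ := Λ) R) (s R) (t R) where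
  vertex_mul_self v := Quot.sound (.vertex_mul_self v)
  vertex_mul_vertex v w h := Quot.sound (.vertex_mul_vertex v w h)
  path_mul_path a b h := Quot.sound (.path_mul_path a b h)
  ghost_mul_ghost a b h := Quot.sound (.ghost_mul_ghost a b h)
  range_mul_path a := Quot.sound (.range_mul_path a)
  path_mul_source a := Quot.sound (.path_mul_source a)
  source_mul_ghost a := Quot.sound (.source_mul_ghost a)
  ghost_mul_range a := Quot.sound (.ghost_mul_range a)
  ghost_mul_path_self a := Quot.sound (.ghost_mul_path_self a)
  ghost_mul_path_of_ne a b hd h := Quot.sound (.ghost_mul_path_of_ne a b hd h)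
  vertex_eq_sum v n hn := by
    refine (Quot.sound (.vertex_eq_sum v n hn)).trans ?_
    change mk (R := R) _ = _
    simp only [map_sum, map_mul]
    rfl

variable {R}

theorem hom_ext {A : Type*} [NonUnitalSemiring A] [Module R A] {f g : Λ.KP R →ₙₐ[R] A}
    (hp : ∀ v, f (p R v) = g (p R v)) (hs : ∀ a, f (s R a) = g (s R a))
    (ht : ∀ a, f (t R a) = g (t R a)) : f = g := by
  have : f.comp mk = g.comp mk := by
    refine MonoidAlgebra.nonUnitalAlgHom_ext' R (FreeSemigroup.hom_ext ?_)
    funext x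
    cases x with
    | vertex v => exact hp v
    | path a => exact hs a
    | ghost a => exact ht a
  ext ⟨a⟩
  exact DFunLike.congr_fun this a

theorem exists_lift {A : Type*} [NonUnitalSemiring A] [Module R A] [IsScalarTower R A A]
    [SMulCommClass R A A] {P : Λ.Vertex → A} {S T : Λ.NZPath → A}
    (h : IsKumjianPaskFamily P S T) : ∃ f : Λ.KP R →ₙₐ[R] A,
      (∀ v, f (p R v) = P v) ∧ (∀ a, f (s R a) = S a) ∧ ∀ a, f (t R a) = T a := by
  let φ : Λ.FreeAlg R →ₙₐ[R] A := MonoidAlgebra.liftMagma R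
    (FreeSemigroup.lift fun g : Λ.Gen => Gen.rec P S T g)
  have hof : ∀ g, φ (FreeAlg.of R g) = Gen.rec P S T g := fun g => by
    simp [φ, FreeAlg.of]
  have hφ : ∀ a b, KPRel R a b → φ a = φ b := by
    intro a b hab
    induction hab with
    | vertex_mul_self v => simpa only [map_mul, hof] using h.vertex_mul_self v
    | vertex_mul_vertex v w hvw =>
      simpa only [map_mul, map_zero, hof] using h.vertex_mul_vertex v w hvw
    | path_mul_path a b hab => simpa only [map_mul, hof] using h.path_mul_path a b hab
    | ghost_mul_ghost a b hab => simpa only [map_mul, hof] using h.ghost_mul_ghost a b hab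
    | range_mul_path a => simpa only [map_mul, hof] using h.range_mul_path a
    | path_mul_source a => simpa only [map_mul, hof] using h.path_mul_source a
    | source_mul_ghost a => simpa only [map_mul, hof] using h.source_mul_ghost a
    | ghost_mul_range a => simpa only [map_mul, hof] using h.ghost_mul_range a
    | ghost_mul_path_self a => simpa only [map_mul, hof] using h.ghost_mul_path_self a
    | ghost_mul_path_of_ne a b hd hab =>
      simpa only [map_mul, map_zero, hof] using h.ghost_mul_path_of_ne a b hd hab
    | vertex_eq_sum v n hn => simpa only [map_mul, map_sum, hof] using h.vertex_eq_sum v n hn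
    | smul t _ ih => rw [map_smul, map_smul, ih]
    | add_right c _ ih => rw [map_add, map_add, ih]
    | mul_left c _ ih => rw [map_mul, map_mul, ih]
    | mul_right c _ ih => rw [map_mul, map_mul, ih]
  refine ⟨{ toFun := fun c => Quot.liftOn c φ hφ
            map_smul' := by rintro r ⟨a⟩; exact map_smul φ r a
            map_zero' := map_zero φ
            map_add' := by rintro ⟨a⟩ ⟨b⟩; exact map_add φ a b
            map_mul' := by rintro ⟨a⟩ ⟨b⟩; exact map_mul φ a b },
    fun v => hof _, fun a => hof _, fun a => hof _⟩

/-- The universal property of the Kumjian-Pask algebra. -/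
theorem existsUnique_lift {A : Type*} [NonUnitalSemiring A] [Module R A] [IsScalarTower R A A]
    [SMulCommClass R A A] {P : Λ.Vertex → A} {S T : Λ.NZPath → A}
    (h : IsKumjianPaskFamily P S T) : ∃! f : Λ.KP R →ₙₐ[R] A,
      (∀ v, f (p R v) = P v) ∧ (∀ a, f (s R a) = S a) ∧ ∀ a, f (t R a) = T a := by
  obtain ⟨f, hf⟩ := exists_lift (R := R) h
  exact ⟨f, hf, fun g hg => hom_ext (fun v => (hg.1 v).trans (hf.1 v).symm)
    (fun a => (hg.2.1 a).trans (hf.2.1 a).symm) fun a => (hg.2.2 a).trans (hf.2.2 a).symm⟩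

theorem exists_involution : ∃ f : Λ.KP R →ₙₐ[R] (Λ.KP R)ᵐᵒᵖ,
    (∀ v, f (p R v) = .op (p R v)) ∧ (∀ a, f (s R a) = .op (t R a)) ∧
      ∀ a, f (t R a) = .op (s R a) := by
  have : IsScalarTower R (Λ.KP R)ᵐᵒᵖ (Λ.KP R)ᵐᵒᵖ := ⟨fun r a b => by
    apply MulOpposite.unop_injective
    exact mul_smul_comm r b.unop a.unop⟩
  have : SMulCommClass R (Λ.KP R)ᵐᵒᵖ (Λ.KP R)ᵐᵒᵖ := ⟨fun r a b => by
    apply MulOpposite.unop_injective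
    exact (smul_mul_assoc r b.unop a.unop).symm⟩
  have h := isKumjianPaskFamily Λ R
  refine exists_lift (P := fun v => MulOpposite.op (p R v)) (S := fun a => MulOpposite.op (t R a))
    (T := fun a => MulOpposite.op (s R a)) ?_
  constructor <;> intros <;> apply MulOpposite.unop_injective
  · exact h.vertex_mul_self _
  · rename_i v w hvw
    exact h.vertex_mul_vertex _ _ hvw.symm
  · exact h.ghost_mul_ghost _ _ _
  · exact h.path_mul_path _ _ _
  · exact h.ghost_mul_range _
  · exact h.source_mul_ghost _
  · exact h.path_mul_source _
  · exact h.range_mul_path _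
  · exact h.ghost_mul_path_self _
  · rename_i a b hd hab
    exact h.ghost_mul_path_of_ne _ _ hd.symm hab.symm
  · rename_i v n hn
    simpa using h.vertex_eq_sum v n hn

/-- The involution `a ↦ a*` of `KP_R(Λ)`: the `R`-linear map that reverses products, fixes every
`p_v` and exchanges `s_a` with `s_{a*}`. -/
noncomputable instance : Star (Λ.KP R) where
  star a := MulOpposite.unop ((exists_involution (Λ := Λ) (R := R)).choose a)

theorem star_mul' (a b : Λ.KP R) : star (a * b) = star b * star a := by
  simp [star]

theorem star_add' (a b : Λ.KP R) : star (a + b) = star a + star b := by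
  simp [star]

theorem star_smul' (r : R) (a : Λ.KP R) : star (r • a) = r • star a := by
  simp [star]

theorem star_p (v : Λ.Vertex) : star (p R v) = p R v :=
  congrArg MulOpposite.unop ((exists_involution (Λ := Λ) (R := R)).choose_spec.1 v)

theorem star_s (a : Λ.NZPath) : star (s R a) = t R a :=
  congrArg MulOpposite.unop ((exists_involution (Λ := Λ) (R := R)).choose_spec.2.1 a)

theorem star_t (a : Λ.NZPath) : star (t R a) = s R a :=
  congrArg MulOpposite.unop ((exists_involution (Λ := Λ) (R := R)).choose_spec.2.2 a)

variable (R)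

open Classical in
/-- `s_a` for an arbitrary path `a`, where `s_v = p_v` for a vertex `v`. A path of degree zero is
the identity at its range. -/
noncomputable def path (a : Λ.Path) : Λ.KP R :=
  if h : Λ.deg a = 0 then p R a.target else s R ⟨a, h⟩

open Classical in
/-- `s_{a*}` for an arbitrary path `a`, where `s_{v*} = p_v` for a vertex `v`. -/
noncomputable def ghost (a : Λ.Path) : Λ.KP R :=
  if h : Λ.deg a = 0 then p R a.target else t R ⟨a, h⟩

theorem star_path_mul_ghost (a b : Λ.Path) :
    star (path R a * ghost R b) = path R b * ghost R a := by
  rw [star_mul']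
  unfold path ghost
  congr 1 <;> split_ifs <;> simp only [star_p, star_s, star_t]

variable (Λ) in
/-- The diagonal subalgebra: the `R`-subalgebra of `KP_R(Λ)` generated by all `s_m s_{m*}`. -/
noncomputable def diagonal : NonUnitalSubalgebra R (Λ.KP R) :=
  NonUnitalAlgebra.adjoin R (Set.range fun m : Λ.Path => path R m * ghost R m)

end KP

end KP

end KGraph

namespace KGraph

variable {k : ℕ} {Λ : KGraph.{w, u} k}

/-! Write `e_l = s_l s_{l*}`. The proof turns identities between these projections into statements
about initial segments. If `deg m ≤ deg l`, then `e_m` fixes `s_l` and `s_{l*}` when `m` is an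
initial segment of `l` (`ghost_mul_proj`, `proj_mul_path`), and annihilates them otherwise. By
(KP4), `s_α s_{β*}` is the sum of the `s_{αλ} s_{(βλ)*}` over `λ` of any chosen degree
(`path_mul_ghost_eq_sum`), so degrees can always be made large enough for this test.

3 → 2: `αλ` and `βλ` begin a common infinite path, hence have the same initial segments of every
degree that fits in both (`isPrefix_of_prepend_eq`). So `e_m` acts alike on the two sides of each
summand, which gives commutation with the diagonal. The same test gives `e_α = e_β`, which is
normality (`isStarNormal_iff`).

2 → 1: conjugation by `s_α s_{β*}` carries `e_{βγ}` to `e_{αγ}`, while commutation and normality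
make it fix `e_{βγ}`.

1 → 3: if `e_a = e_b`, every sufficiently long extension of `a` begins with `b`
(`isPrefix_of_proj_eq`); otherwise some `s_{l*}` would vanish. That this is impossible rests on `p_v
≠ 0`, seen in the representation on functions on infinite paths. Applied to `α x(0,n)` and `β
x(0,n)`, it gives `αx = βx`. -/

theorem eq_id_or_deg_ne_zero (a : Λ.Path) : (∃ v, a = Mor.id v) ∨ Λ.deg a ≠ 0 := by
  by_cases h : Λ.deg a = 0
  · exact .inl ⟨_, eq_id_of_deg_eq_zero h⟩
  · exact .inr h

/-! ### Initial segments of finite paths -/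

/-- `a` is an initial segment of `l`. -/
def IsPrefix (a l : Λ.Path) : Prop := ∃ b, ∃ h : a.source = b.target, l = a.comp b h

namespace IsPrefix

variable {a b l : Λ.Path}

theorem comp (a b : Λ.Path) (h : a.source = b.target) : IsPrefix a (a.comp b h) := ⟨b, h, rfl⟩

theorem trans (h : IsPrefix a b) (h' : IsPrefix b l) : IsPrefix a l := by
  obtain ⟨c, hc, rfl⟩ := h
  obtain ⟨d, hd, rfl⟩ := h'
  exact ⟨c.comp d hd, hc, Mor.comp_assoc _ _ _ _ _⟩

theorem eq_of_deg_eq (ha : IsPrefix a l) (hb : IsPrefix b l) (hd : Λ.deg a = Λ.deg b) : a = b := by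
  obtain ⟨c, hc, rfl⟩ := ha
  obtain ⟨d, hd', e⟩ := hb
  exact (comp_inj _ _ hd e).1

theorem exists_deg_eq (l : Λ.Path) {n : Fin k → ℕ} (hn : n ≤ Λ.deg l) :
    ∃ a, IsPrefix a l ∧ Λ.deg a = n := by
  obtain ⟨⟨a, b⟩, ⟨ha, -, h, e⟩, -⟩ := Λ.factorization l n (Λ.deg l - n)
    (add_tsub_cancel_of_le hn).symm
  exact ⟨a, ⟨b, h, e⟩, ha⟩

/-- Cut `b` at the degree of `a`: the piece is an initial segment of `l` of that degree, so it is
`a` by unique factorization. Degrees are only partially ordered, so two initial segments of `l` need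
not be comparable in general. -/
theorem of_deg_le (ha : IsPrefix a l) (hb : IsPrefix b l) (hd : Λ.deg a ≤ Λ.deg b) :
    IsPrefix a b := by
  obtain ⟨c, hc, hdc⟩ := exists_deg_eq b hd
  rwa [← (hc.trans hb).eq_of_deg_eq ha hdc]

theorem target_eq (ha : IsPrefix a l) : a.target = l.target := by
  obtain ⟨c, hc, rfl⟩ := ha
  rfl

end IsPrefix

/-! ### Infinite paths: existence, shift and prepending -/

namespace InfPath

theorem seg_isPrefix (x : Λ.InfPath) {p q : Fin k → ℕ} (h : p ≤ q) :
    IsPrefix (x.seg 0 p zero_le) (x.seg 0 q zero_le) :=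
  ⟨_, x.source_eq_target 0 p q zero_le h, (x.seg_comp 0 p q zero_le h).symm⟩

/-- In a `k`-graph without sources every vertex is the range of an infinite path. -/
theorem exists_range_eq [Λ.NoSources] (v : Λ.Vertex) : ∃ x : Λ.InfPath, x.range = v := by
  choose e he using fun v => NoSources.nonempty (Λ := Λ) v (fun _ => 1)
  -- Appending paths of degree `(1, …, 1)` gives a chain cofinal in `ℕ^k`.
  let L : ℕ → Λ.Path := fun N => Nat.rec (Mor.id v) (fun _ l => l.comp (e l.source) (he _).1.symm) N
  have hL : ∀ N, L (N + 1) = (L N).comp (e (L N).source) (he _).1.symm := fun N => rfl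
  have hdeg : ∀ N, Λ.deg (L N) = fun _ => N := by
    intro N
    induction N with
    | zero => exact Λ.deg_id v
    | succ N ih =>
      rw [hL, Λ.deg_comp, ih, (he _).2]
      rfl
  have hmono : ∀ M N, M ≤ N → IsPrefix (L M) (L N) := by
    intro M N h
    induction N, h using Nat.le_induction with
    | base => exact ⟨_, rfl, (Mor.comp_id _).symm⟩
    | succ N _ ih => exact ih.trans ⟨_, _, hL N⟩
  -- The coordinate sum bounds every coordinate of `n` and is monotone in `n`, so the segments of
  -- degree `n` cut from `L (∑ i, n i)` are compatible.
  have hle : ∀ n : Fin k → ℕ, n ≤ Λ.deg (L (∑ i, n i)) := fun n i => by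
    rw [hdeg]
    exact Finset.single_le_sum (fun _ _ => Nat.zero_le _) (Finset.mem_univ i)
  choose y hy hdy using fun n => IsPrefix.exists_deg_eq _ (hle n)
  obtain ⟨x, hx⟩ := exists_of_compatible y hdy fun p q hpq =>
    ((hy p).trans (hmono _ _ (Finset.sum_le_sum fun i _ => hpq i))).of_deg_le (hy q)
      (by rw [hdy, hdy]; exact hpq)
  refine ⟨x, ?_⟩
  rw [x.range_eq_target 0, hx, (hy 0).target_eq, ← (hmono 0 _ (Nat.zero_le _)).target_eq]
  rfl

/-- The infinite path `x` without its initial segment of degree `n`. -/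
def shift (x : Λ.InfPath) (n : Fin k → ℕ) : Λ.InfPath where
  toFunctor :=
    -- The sum is written coordinatewise because `Omega k` carries no addition.
    { obj := fun p => x.toFunctor.obj (.of fun i => p i + n i)
      map := fun {q p} f => x.toFunctor.map
        (Omega.mor (fun i => p i + n i) (fun i => q i + n i) fun i => Nat.add_le_add_right (f.down i) _)
      map_id := fun _ => x.toFunctor.map_id _
      map_comp := fun _ _ => x.toFunctor.map_comp (Omega.mor _ _ _) (Omega.mor _ _ _) }
  deg_map p q h := (x.deg_map (p + n) (q + n) (add_le_add_left h n)).trans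
    (add_tsub_add_eq_tsub_right q n p)

theorem seg_shift (x : Λ.InfPath) (n p q : Fin k → ℕ) (h : p ≤ q) :
    (x.shift n).seg p q h = x.seg (p + n) (q + n) (add_le_add_left h n) := rfl

theorem seg_congr (x : Λ.InfPath) {p p' q q' : Fin k → ℕ} (hp : p = p') (hq : q = q')
    (h : p ≤ q) : x.seg p q h = x.seg p' q' (hp ▸ hq ▸ h) := by
  subst hp; subst hq; rfl

theorem range_shift (x : Λ.InfPath) (n : Fin k → ℕ) :
    (x.shift n).range = (x.seg 0 n zero_le).source :=
  congrArg (fun m => x.toFunctor.obj (.of m)) (zero_add n)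

theorem shift_shift (x : Λ.InfPath) (m n : Fin k → ℕ) :
    (x.shift m).shift n = x.shift (m + n) :=
  ext_seg fun p q h => by
    rw [seg_shift, seg_shift, seg_shift]
    exact x.seg_congr (by rw [add_assoc, add_comm m]) (by rw [add_assoc, add_comm m]) _

theorem seg_comp_shift (x : Λ.InfPath) (n q : Fin k → ℕ) :
    (x.seg 0 n zero_le).comp ((x.shift n).seg 0 q zero_le) (x.range_shift n).symm =
      x.seg 0 (q + n) zero_le := by
  rw [← x.seg_comp 0 n (q + n) zero_le le_add_self]
  exact Mor.comp_congr rfl (x.seg_congr (zero_add n) rfl _) _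

theorem seg_prepend (a : Λ.Path) (x : Λ.InfPath) (h : a.source = x.range) (q : Fin k → ℕ) :
    (prepend a x h).seg 0 (q + Λ.deg a) zero_le =
      a.comp (x.seg 0 q zero_le) (h.trans (x.range_eq_target q)) := by
  rw [prepend_spec a x h _ le_add_self]
  exact Mor.comp_congr rfl (x.seg_congr rfl (add_tsub_cancel_right _ _) _) _

/-- Every `n ≥ deg a` is some `q + deg a`; this form of the characterization of `a x` avoids
truncated subtraction. -/
theorem eq_prepend {a : Λ.Path} {x y : Λ.InfPath} (h : a.source = x.range)
    (hy : ∀ q, y.seg 0 (q + Λ.deg a) zero_le =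
      a.comp (x.seg 0 q zero_le) (h.trans (x.range_eq_target q))) :
    y = prepend a x h := by
  refine (existsUnique_prepend a x h).unique (fun n hn => ?_) (prepend_spec a x h)
  rw [← hy]
  exact y.seg_congr rfl (tsub_add_cancel_of_le hn).symm _

theorem seg_prepend_deg (a : Λ.Path) (x : Λ.InfPath) (h : a.source = x.range) :
    (prepend a x h).seg 0 (Λ.deg a) zero_le = a := by
  rw [seg_congr _ rfl (zero_add (Λ.deg a)).symm, seg_prepend]
  refine (Mor.comp_congr rfl ?_ _).trans (Mor.comp_id a)
  rw [h]
  exact eq_id_of_deg_eq_zero (x.deg_seg_zero 0)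

theorem range_prepend (a : Λ.Path) (x : Λ.InfPath) (h : a.source = x.range) :
    (prepend a x h).range = a.target := by
  rw [range_eq_target _ (Λ.deg a), seg_prepend_deg]

theorem range_of_seg_eq {a : Λ.Path} {x : Λ.InfPath} (h : x.seg 0 (Λ.deg a) zero_le = a) :
    x.range = a.target := by
  rw [x.range_eq_target (Λ.deg a), h]

theorem source_of_seg_eq {a : Λ.Path} {x : Λ.InfPath} (h : x.seg 0 (Λ.deg a) zero_le = a) :
    a.source = (x.shift (Λ.deg a)).range := by
  rw [range_shift, h]

theorem prepend_shift {a : Λ.Path} {x : Λ.InfPath} (h : x.seg 0 (Λ.deg a) zero_le = a) :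
    prepend a (x.shift (Λ.deg a)) (source_of_seg_eq h) = x := by
  refine (eq_prepend _ fun q => ?_).symm
  rw [← x.seg_comp_shift]
  exact Mor.comp_congr h rfl _

theorem shift_prepend (a : Λ.Path) (x : Λ.InfPath) (h : a.source = x.range) :
    (prepend a x h).shift (Λ.deg a) = x := by
  refine ext_seg_zero fun q => ?_
  have e := (prepend a x h).seg_comp_shift (Λ.deg a) q
  rw [seg_prepend] at e
  exact (comp_inj _ _ (by rw [seg_prepend_deg]) e).2

theorem prepend_comp (a b : Λ.Path) (x : Λ.InfPath) (h : a.source = b.target)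
    (hx : b.source = x.range) :
    prepend (a.comp b h) x hx = prepend a (prepend b x hx) (h.trans (range_prepend b x hx).symm) := by
  refine (eq_prepend (a := a.comp b h) hx fun q => ?_).symm
  rw [seg_congr _ rfl (show q + Λ.deg (a.comp b h) = q + Λ.deg b + Λ.deg a by
    rw [Λ.deg_comp, add_assoc, add_comm (Λ.deg a)]), seg_prepend, Mor.comp_assoc _ _ _ _ hx]
  exact Mor.comp_congr rfl (seg_prepend b x hx q) _

/-- Unique factorization for cylinder sets; it makes the operators of paths multiplicative. -/
theorem seg_eq_comp_iff (a b : Λ.Path) (h : a.source = b.target) (x : Λ.InfPath) :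
    x.seg 0 (Λ.deg (a.comp b h)) zero_le = a.comp b h ↔
      x.seg 0 (Λ.deg a) zero_le = a ∧ (x.shift (Λ.deg a)).seg 0 (Λ.deg b) zero_le = b := by
  have e : x.seg 0 (Λ.deg (a.comp b h)) zero_le = x.seg 0 (Λ.deg b + Λ.deg a) zero_le :=
    x.seg_congr rfl (by rw [Λ.deg_comp, add_comm]) _
  rw [e, ← x.seg_comp_shift]
  refine ⟨fun h' => comp_inj _ _ (x.deg_seg_zero _) h', fun h' => Mor.comp_congr h'.1 h'.2 _⟩

theorem isPrefix_of_seg_eq {a b : Λ.Path} {x : Λ.InfPath} (ha : x.seg 0 (Λ.deg a) zero_le = a)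
    (hb : x.seg 0 (Λ.deg b) zero_le = b) (h : Λ.deg a ≤ Λ.deg b) : IsPrefix a b := by
  rw [← ha, ← hb]
  exact x.seg_isPrefix h

theorem seg_eq_of_isPrefix {a b : Λ.Path} {x : Λ.InfPath} (h : IsPrefix a b)
    (hb : x.seg 0 (Λ.deg b) zero_le = b) : x.seg 0 (Λ.deg a) zero_le = a := by
  obtain ⟨c, hc, rfl⟩ := h
  exact ((seg_eq_comp_iff _ _ _ _).1 hb).1

/-- If `a x = b x` for all infinite paths `x`, then `a c` and `b c` have the same initial segments
of any degree that both degrees allow. -/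
theorem isPrefix_of_prepend_eq [Λ.NoSources] {a b : Λ.Path} (hs : a.source = b.source)
    (H : ∀ (x : Λ.InfPath) (hx : a.source = x.range),
      prepend a x hx = prepend b x (hs.symm.trans hx)) {c m : Λ.Path} (hc : a.source = c.target)
    (hm : IsPrefix m (a.comp c hc)) (hd : Λ.deg m ≤ Λ.deg (b.comp c (hs.symm.trans hc))) :
    IsPrefix m (b.comp c (hs.symm.trans hc)) := by
  obtain ⟨x, hx⟩ := exists_range_eq c.source
  have e : prepend (a.comp c hc) x hx.symm = prepend (b.comp c (hs.symm.trans hc)) x hx.symm := by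
    rw [prepend_comp a c x hc hx.symm, prepend_comp b c x _ hx.symm]
    exact H _ _
  refine isPrefix_of_seg_eq (x := prepend (a.comp c hc) x hx.symm) ?_ ?_ hd
  · exact seg_eq_of_isPrefix hm (seg_prepend_deg _ _ _)
  · rw [e]
    exact seg_prepend_deg _ _ _

/-! ### The infinite path representation -/

section Representation

variable (R : Type*) [CommRing R]

open Classical in
/-- The operator of a vertex on the functions on the infinite paths. -/
noncomputable def vertexOp (v : Λ.Vertex) : Module.End R (Λ.InfPath → R) where
  toFun f x := if x.range = v then f x else 0
  map_add' f g := by ext x; simp only [Pi.add_apply]; split_ifs <;> simp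
  map_smul' r f := by ext x; simp

open Classical in
/-- The operator of a path on the functions on the infinite paths. -/
noncomputable def pathOp (a : Λ.Path) : Module.End R (Λ.InfPath → R) where
  toFun f x := if x.seg 0 (Λ.deg a) zero_le = a then f (x.shift (Λ.deg a)) else 0
  map_add' f g := by ext x; simp only [Pi.add_apply]; split_ifs <;> simp
  map_smul' r f := by ext x; simp

open Classical in
/-- The operator of a ghost path on the functions on the infinite paths. -/
noncomputable def ghostOp (a : Λ.Path) : Module.End R (Λ.InfPath → R) where
  toFun f x := if h : a.source = x.range then f (prepend a x h) else 0
  map_add' f g := by ext x; simp only [Pi.add_apply]; split_ifs <;> simp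
  map_smul' r f := by ext x; simp

open Classical in
theorem vertexOp_apply (v : Λ.Vertex) (f : Λ.InfPath → R) (x : Λ.InfPath) :
    vertexOp R v f x = if x.range = v then f x else 0 := rfl

open Classical in
theorem pathOp_apply (a : Λ.Path) (f : Λ.InfPath → R) (x : Λ.InfPath) :
    pathOp R a f x = if x.seg 0 (Λ.deg a) zero_le = a then f (x.shift (Λ.deg a)) else 0 := rfl

open Classical in
theorem ghostOp_apply (a : Λ.Path) (f : Λ.InfPath → R) (x : Λ.InfPath) :
    ghostOp R a f x = if h : a.source = x.range then f (prepend a x h) else 0 := rfl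

/-- The product is multiplication by the indicator of the cylinder set of `a`. Thus (KP4) says that
the cylinders of `v Λ^n` partition the infinite paths with range `v`. -/
theorem pathOp_mul_ghostOp_apply (a : Λ.Path) (f : Λ.InfPath → R) (x : Λ.InfPath)
    [Decidable (x.seg 0 (Λ.deg a) zero_le = a)] : (pathOp R a * ghostOp R a) f x =
      if x.seg 0 (Λ.deg a) zero_le = a then f x else 0 := by
  rw [Module.End.mul_apply, pathOp_apply]
  split_ifs with h
  · rw [ghostOp_apply, dif_pos (source_of_seg_eq h), prepend_shift h]
  · rfl

/-- The infinite path representation. -/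
theorem isKumjianPaskFamily_op [Λ.RowFinite] :
    IsKumjianPaskFamily (Λ := Λ) (vertexOp R) (fun a => pathOp R a.1) (fun a => ghostOp R a.1) where
  vertex_mul_self v := by
    ext1 f; funext x
    simp +contextual [vertexOp_apply]
  vertex_mul_vertex v w h := by
    ext1 f; funext x
    simp only [Module.End.mul_apply, vertexOp_apply]
    split_ifs with h1 h2
    · exact absurd (h1.symm.trans h2) h
    all_goals rfl
  path_mul_path a b h := by
    ext1 f; funext x
    change _ = pathOp R (a.1.comp b.1 h) f x
    simp only [Module.End.mul_apply, pathOp_apply, shift_shift, ← ite_and]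
    by_cases hx : x.seg 0 (Λ.deg (a.1.comp b.1 h)) zero_le = a.1.comp b.1 h
    · rw [if_pos hx, if_pos ((seg_eq_comp_iff _ _ _ _).1 hx), Λ.deg_comp]
    · rw [if_neg hx, if_neg (mt (seg_eq_comp_iff _ _ _ _).2 hx)]
  ghost_mul_ghost a b h := by
    ext1 f; funext x
    change _ = ghostOp R (a.1.comp b.1 h) f x
    simp only [Module.End.mul_apply, ghostOp_apply]
    by_cases hx : b.1.source = x.range
    · rw [dif_pos hx, dif_pos (h.trans (range_prepend _ _ _).symm)]
      rw [dif_pos (show (a.1.comp b.1 h).source = x.range from hx), prepend_comp]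
    · rw [dif_neg hx, dif_neg (show ¬(a.1.comp b.1 h).source = x.range from hx)]
  range_mul_path a := by
    ext1 f; funext x
    simp only [Module.End.mul_apply, vertexOp_apply, pathOp_apply]
    split_ifs with h1 h2 h3
    · rfl
    · rfl
    · exact absurd (range_of_seg_eq h3) h1
    · rfl
  path_mul_source a := by
    ext1 f; funext x
    simp only [Module.End.mul_apply, vertexOp_apply, pathOp_apply]
    split_ifs with h1 h2
    · rfl
    · exact absurd (source_of_seg_eq h1).symm h2
    · rfl
  source_mul_ghost a := by
    ext1 f; funext x
    simp only [Module.End.mul_apply, vertexOp_apply, ghostOp_apply]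
    split_ifs with h1 h2 h3
    · rfl
    · exact absurd h1.symm h2
    · exact absurd h3.symm h1
    · rfl
  ghost_mul_range a := by
    ext1 f; funext x
    simp only [Module.End.mul_apply, vertexOp_apply, ghostOp_apply]
    split_ifs with h1 h2
    · rfl
    · exact absurd (range_prepend _ _ _) h2
    · rfl
  ghost_mul_path_self a := by
    ext1 f; funext x
    simp only [Module.End.mul_apply, vertexOp_apply, ghostOp_apply, pathOp_apply]
    by_cases h : a.1.source = x.range
    · rw [dif_pos h, if_pos (seg_prepend_deg _ _ _), shift_prepend, if_pos h.symm]
    · rw [dif_neg h, if_neg (Ne.symm h)]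
  ghost_mul_path_of_ne a b hd hab := by
    ext1 f; funext x
    simp only [Module.End.mul_apply, ghostOp_apply, pathOp_apply]
    split_ifs with h1 h2
    · rw [seg_congr _ rfl hd.symm, seg_prepend_deg] at h2
      exact absurd (Subtype.ext h2) hab
    all_goals rfl
  vertex_eq_sum v n hn := by
    classical
    ext1 f; funext x
    rw [LinearMap.sum_apply, Finset.sum_apply]
    simp only [pathOp_mul_ghostOp_apply, vertexOp_apply, NZPath.ofPathsTo]
    split_ifs with h
    -- Only the cylinder of `x(0, n)` contains `x`.
    · rw [Fintype.sum_eq_single ⟨x.seg 0 n zero_le, h, x.deg_seg_zero n⟩, if_pos]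
      · exact x.seg_congr rfl (x.deg_seg_zero n) _
      · intro l hl
        refine if_neg fun e => hl (Subtype.ext ?_)
        rw [x.seg_congr rfl l.2.2] at e
        exact e.symm
    · refine (Finset.sum_eq_zero fun l _ => if_neg fun e => h ?_).symm
      exact (range_of_seg_eq e).trans l.2.1

end Representation

end InfPath

/-! ### Calculation in the Kumjian-Pask algebra, with vertices treated as paths of degree zero -/

namespace KP

variable [Λ.RowFinite] (R : Type*) [CommRing R]

/-- In the infinite path representation `p_v` is multiplication by the indicator of `v Λ^∞`, which
is nonempty, so it does not kill the constant function `1`. -/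
theorem p_ne_zero [Λ.NoSources] [Nontrivial R] (v : Λ.Vertex) : p R v ≠ 0 := by
  intro h
  obtain ⟨f, hf, -⟩ := exists_lift (R := R) (InfPath.isKumjianPaskFamily_op (Λ := Λ) R)
  obtain ⟨x, hx⟩ := InfPath.exists_range_eq v
  have e := hf v
  rw [h, map_zero] at e
  have := congrFun (LinearMap.congr_fun e fun _ => (1 : R)) x
  rw [InfPath.vertexOp_apply, if_pos hx] at this
  exact zero_ne_one this

theorem path_id (v : Λ.Vertex) : path R (Mor.id v) = p R v := dif_pos (Λ.deg_id v)

theorem ghost_id (v : Λ.Vertex) : ghost R (Mor.id v) = p R v := dif_pos (Λ.deg_id v)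

theorem path_of_ne {a : Λ.Path} (h : Λ.deg a ≠ 0) : path R a = s R ⟨a, h⟩ := dif_neg h

theorem ghost_of_ne {a : Λ.Path} (h : Λ.deg a ≠ 0) : ghost R a = t R ⟨a, h⟩ := dif_neg h

variable {R}

theorem p_mul_path (a : Λ.Path) : p R a.target * path R a = path R a := by
  obtain ⟨v, rfl⟩ | h := eq_id_or_deg_ne_zero a
  · rw [path_id]
    exact (isKumjianPaskFamily Λ R).vertex_mul_self v
  · rw [path_of_ne R h]
    exact (isKumjianPaskFamily Λ R).range_mul_path ⟨a, h⟩

theorem path_mul_p (a : Λ.Path) : path R a * p R a.source = path R a := by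
  obtain ⟨v, rfl⟩ | h := eq_id_or_deg_ne_zero a
  · rw [path_id]
    exact (isKumjianPaskFamily Λ R).vertex_mul_self v
  · rw [path_of_ne R h]
    exact (isKumjianPaskFamily Λ R).path_mul_source ⟨a, h⟩

theorem p_mul_ghost (a : Λ.Path) : p R a.source * ghost R a = ghost R a := by
  obtain ⟨v, rfl⟩ | h := eq_id_or_deg_ne_zero a
  · rw [ghost_id]
    exact (isKumjianPaskFamily Λ R).vertex_mul_self v
  · rw [ghost_of_ne R h]
    exact (isKumjianPaskFamily Λ R).source_mul_ghost ⟨a, h⟩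

theorem ghost_mul_p (a : Λ.Path) : ghost R a * p R a.target = ghost R a := by
  obtain ⟨v, rfl⟩ | h := eq_id_or_deg_ne_zero a
  · rw [ghost_id]
    exact (isKumjianPaskFamily Λ R).vertex_mul_self v
  · rw [ghost_of_ne R h]
    exact (isKumjianPaskFamily Λ R).ghost_mul_range ⟨a, h⟩

theorem path_comp (a b : Λ.Path) (h : a.source = b.target) :
    path R (a.comp b h) = path R a * path R b := by
  obtain ⟨v, rfl⟩ | ha := eq_id_or_deg_ne_zero a
  · obtain rfl : v = b.target := h
    rw [Mor.id_comp, path_id, p_mul_path]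
  obtain ⟨v, rfl⟩ | hb := eq_id_or_deg_ne_zero b
  · obtain rfl : a.source = v := h
    rw [Mor.comp_id, path_id, path_mul_p]
  · rw [path_of_ne R ha, path_of_ne R hb, path_of_ne R (a := a.comp b h) (NZPath.comp ⟨a, ha⟩ ⟨b, hb⟩ h).2]
    exact ((isKumjianPaskFamily Λ R).path_mul_path ⟨a, ha⟩ ⟨b, hb⟩ h).symm

theorem ghost_comp (a b : Λ.Path) (h : a.source = b.target) :
    ghost R (a.comp b h) = ghost R b * ghost R a := by
  obtain ⟨v, rfl⟩ | ha := eq_id_or_deg_ne_zero a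
  · obtain rfl : v = b.target := h
    rw [Mor.id_comp, ghost_id, ghost_mul_p]
  obtain ⟨v, rfl⟩ | hb := eq_id_or_deg_ne_zero b
  · obtain rfl : a.source = v := h
    rw [Mor.comp_id, ghost_id, p_mul_ghost]
  · rw [ghost_of_ne R ha, ghost_of_ne R hb, ghost_of_ne R (a := a.comp b h)
      (NZPath.comp ⟨a, ha⟩ ⟨b, hb⟩ h).2]
    exact ((isKumjianPaskFamily Λ R).ghost_mul_ghost ⟨a, ha⟩ ⟨b, hb⟩ h).symm

theorem ghost_mul_path_self (a : Λ.Path) : ghost R a * path R a = p R a.source := by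
  obtain ⟨v, rfl⟩ | h := eq_id_or_deg_ne_zero a
  · rw [path_id, ghost_id]
    exact (isKumjianPaskFamily Λ R).vertex_mul_self v
  · rw [path_of_ne R h, ghost_of_ne R h]
    exact (isKumjianPaskFamily Λ R).ghost_mul_path_self ⟨a, h⟩

theorem ghost_mul_path_of_ne {a b : Λ.Path} (hd : Λ.deg a = Λ.deg b) (hab : a ≠ b) :
    ghost R a * path R b = 0 := by
  obtain ⟨v, rfl⟩ | h := eq_id_or_deg_ne_zero a
  · obtain ⟨w, rfl⟩ | h' := eq_id_or_deg_ne_zero b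
    · rw [path_id, ghost_id]
      exact (isKumjianPaskFamily Λ R).vertex_mul_vertex v w fun e => hab (e ▸ rfl)
    · exact absurd (hd.symm.trans (Λ.deg_id v)) h'
  · rw [path_of_ne R (hd ▸ h), ghost_of_ne R h]
    exact (isKumjianPaskFamily Λ R).ghost_mul_path_of_ne _ _ hd fun e => hab (congrArg Subtype.val e)

theorem p_eq_sum (v : Λ.Vertex) (n : Fin k → ℕ) :
    p R v = ∑ l : Λ.pathsTo v n, path R l.1 * ghost R l.1 := by
  by_cases hn : n = 0
  · subst hn
    rw [Fintype.sum_eq_single ⟨Mor.id v, rfl, Λ.deg_id v⟩, path_id, ghost_id]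
    · exact ((isKumjianPaskFamily Λ R).vertex_mul_self v).symm
    · rintro ⟨l, rfl, h⟩ hl
      exact absurd (Subtype.ext (eq_id_of_deg_eq_zero h)) hl
  · refine ((isKumjianPaskFamily Λ R).vertex_eq_sum v n hn).trans
      (Finset.sum_congr rfl fun l _ => ?_)
    rw [path_of_ne R (a := l.1) (NZPath.ofPathsTo hn l).2,
      ghost_of_ne R (a := l.1) (NZPath.ofPathsTo hn l).2]
    rfl

/-- (KP4) at the common source, inserted between the two factors. It lengthens both paths by degree
`n`, enough to compare them with any given path. -/
theorem path_mul_ghost_eq_sum (a b : Λ.Path) (h : a.source = b.source) (n : Fin k → ℕ) :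
    path R a * ghost R b = ∑ l : Λ.pathsTo a.source n,
      path R (a.comp l.1 l.2.1.symm) * ghost R (b.comp l.1 (h.symm.trans l.2.1.symm)) := by
  conv_lhs => rw [← path_mul_p, p_eq_sum a.source n, Finset.mul_sum, Finset.sum_mul]
  simp only [path_comp, ghost_comp, mul_assoc]

theorem ghost_mul_path_mul_ghost (a : Λ.Path) :
    ghost R a * (path R a * ghost R a) = ghost R a := by
  rw [← mul_assoc, ghost_mul_path_self, p_mul_ghost]

theorem path_mul_ghost_mul_path (a : Λ.Path) :
    path R a * ghost R a * path R a = path R a := by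
  rw [mul_assoc, ghost_mul_path_self, path_mul_p]

theorem ghost_mul_proj {m l : Λ.Path} (h : IsPrefix m l) :
    ghost R l * (path R m * ghost R m) = ghost R l := by
  obtain ⟨c, hc, rfl⟩ := h
  rw [ghost_comp, mul_assoc, ghost_mul_path_mul_ghost]

theorem proj_mul_path {m l : Λ.Path} (h : IsPrefix m l) :
    path R m * ghost R m * path R l = path R l := by
  obtain ⟨c, hc, rfl⟩ := h
  rw [path_comp, ← mul_assoc, path_mul_ghost_mul_path]

/-- The initial segment of `l` of degree `deg m` differs from `m`, so (KP3) gives zero. -/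
theorem ghost_mul_path_of_not_isPrefix {m l : Λ.Path} (h : ¬ IsPrefix m l)
    (hd : Λ.deg m ≤ Λ.deg l) : ghost R l * path R m = 0 := by
  obtain ⟨c, ⟨b, hb, rfl⟩, hc⟩ := IsPrefix.exists_deg_eq l hd
  rw [ghost_comp, mul_assoc, ghost_mul_path_of_ne hc, mul_zero]
  rintro rfl
  exact h ⟨b, hb, rfl⟩

theorem ghost_mul_path_of_not_isPrefix' {m l : Λ.Path} (h : ¬ IsPrefix m l)
    (hd : Λ.deg m ≤ Λ.deg l) : ghost R m * path R l = 0 := by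
  obtain ⟨c, ⟨b, hb, rfl⟩, hc⟩ := IsPrefix.exists_deg_eq l hd
  rw [path_comp, ← mul_assoc, ghost_mul_path_of_ne hc.symm, zero_mul]
  rintro rfl
  exact h ⟨b, hb, rfl⟩

theorem ghost_ne_zero [Λ.NoSources] [Nontrivial R] (a : Λ.Path) : ghost R a ≠ 0 := fun h =>
  p_ne_zero R a.source (by rw [← ghost_mul_path_self, h, zero_mul])

/-- If `b` did not begin `l`, then `s_{l*} = s_{l*} e_a = s_{l*} e_b = 0`, which `ghost_ne_zero`
excludes. -/
theorem isPrefix_of_proj_eq [Λ.NoSources] [Nontrivial R] {a b l : Λ.Path}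
    (h : path R a * ghost R a = path R b * ghost R b) (ha : IsPrefix a l)
    (hd : Λ.deg b ≤ Λ.deg l) : IsPrefix b l := by
  by_contra hb
  refine ghost_ne_zero (R := R) l ?_
  rw [← ghost_mul_proj ha, h, ← mul_assoc, ghost_mul_path_of_not_isPrefix hb hd, zero_mul]

/-- As the sources agree, the middle factors collapse to a vertex: the two products of `s_a s_{b*}`
with its adjoint are `e_a` and `e_b`. -/
theorem isStarNormal_iff (a b : Λ.Path) (hs : a.source = b.source) :
    IsStarNormal (path R a * ghost R b) ↔ path R a * ghost R a = path R b * ghost R b := by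
  have key : ∀ a b : Λ.Path, a.source = b.source →
      path R a * ghost R b * (path R b * ghost R a) = path R a * ghost R a := fun a b hs => by
    rw [mul_assoc, ← mul_assoc (ghost R b), ghost_mul_path_self, ← hs, p_mul_ghost]
  rw [_root_.isStarNormal_iff, star_path_mul_ghost, commute_iff_eq, key a b hs, key b a hs.symm, eq_comm]

end KP

end KGraph

theorem proposition4p1 {k : ℕ} (hk : 0 < k) (Λ : KGraph.{w, u} k) [Λ.RowFinite] [Λ.NoSources]
    (R : Type*) [CommRing R] [Nontrivial R] (α β : Λ.Path) (hs : α.source = β.source) :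
    List.TFAE [
      ∀ (γ : Λ.Path) (hγ : α.source = γ.target),
        KGraph.KP.path R (α.comp γ hγ) * KGraph.KP.ghost R (α.comp γ hγ) =
          KGraph.KP.path R (β.comp γ (hs.symm.trans hγ)) *
            KGraph.KP.ghost R (β.comp γ (hs.symm.trans hγ)),
      IsStarNormal (KGraph.KP.path R α * KGraph.KP.ghost R β) ∧
        ∀ d ∈ KGraph.KP.diagonal Λ R, Commute (KGraph.KP.path R α * KGraph.KP.ghost R β) d,
      ∀ (x : Λ.InfPath) (hx : α.source = x.range),
        KGraph.InfPath.prepend α x hx = KGraph.InfPath.prepend β x (hs.symm.trans hx)] := by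
  open KGraph KGraph.KP in
  tfae_have 3 → 2 := fun H => by
    have H' : ∀ (x : Λ.InfPath) (hx : β.source = x.range),
        InfPath.prepend β x hx = InfPath.prepend α x (hs.trans hx) := fun x hx =>
      (H x (hs.trans hx)).symm
    constructor
    · rw [KP.isStarNormal_iff α β hs]
      -- Both ends equal `e_β e_α`. Expand `e_α` over `λ` of degree `deg β`: since `β` begins `βλ`,
      -- it also begins `αλ`, so `e_β` fixes `s_{αλ}`. The other half is symmetric.
      trans path R β * ghost R β * (path R α * ghost R α)
      · conv_lhs => rw [path_mul_ghost_eq_sum α α rfl (Λ.deg β)]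
        conv_rhs => rw [path_mul_ghost_eq_sum α α rfl (Λ.deg β)]
        rw [Finset.mul_sum]
        refine Finset.sum_congr rfl fun l _ => ?_
        rw [← mul_assoc, proj_mul_path]
        refine InfPath.isPrefix_of_prepend_eq hs.symm H' (hs.symm.trans l.2.1.symm)
          (IsPrefix.comp _ _ _) ?_
        rw [Λ.deg_comp, l.2.2]
        exact le_add_self
      · conv_lhs => rw [path_mul_ghost_eq_sum β β rfl (Λ.deg α)]
        conv_rhs => rw [path_mul_ghost_eq_sum β β rfl (Λ.deg α)]
        rw [Finset.sum_mul]
        refine Finset.sum_congr rfl fun l _ => ?_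
        rw [mul_assoc, ghost_mul_proj]
        refine InfPath.isPrefix_of_prepend_eq hs H (hs.trans l.2.1.symm) (IsPrefix.comp _ _ _) ?_
        rw [Λ.deg_comp, l.2.2]
        exact le_add_self
    · intro d hd
      induction hd using NonUnitalAlgebra.adjoin_induction with
      | mem d hd =>
        obtain ⟨m, rfl⟩ := hd
        change _ * _ = _ * _
        -- Now `αλ` and `βλ` both have degree at least `deg m`, so `m` begins both or neither: `e_m`
        -- is absorbed on both sides or gives zero on both.
        rw [path_mul_ghost_eq_sum α β hs (Λ.deg m), Finset.sum_mul, Finset.mul_sum]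
        refine Finset.sum_congr rfl fun l _ => ?_
        have hα : Λ.deg m ≤ Λ.deg (α.comp l.1 l.2.1.symm) := by
          rw [Λ.deg_comp, l.2.2]
          exact le_add_self
        have hβ : Λ.deg m ≤ Λ.deg (β.comp l.1 (hs.symm.trans l.2.1.symm)) := by
          rw [Λ.deg_comp, l.2.2]
          exact le_add_self
        by_cases hm : IsPrefix m (α.comp l.1 l.2.1.symm)
        · rw [mul_assoc, ghost_mul_proj (InfPath.isPrefix_of_prepend_eq hs H _ hm hβ), ← mul_assoc,
            proj_mul_path hm]
        · have hm' := fun h => hm (InfPath.isPrefix_of_prepend_eq hs.symm H'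
            (hs.symm.trans l.2.1.symm) h hα)
          rw [mul_assoc, ← mul_assoc (ghost R _), ghost_mul_path_of_not_isPrefix hm' hβ, zero_mul,
            mul_zero, ← mul_assoc, mul_assoc (path R m), ghost_mul_path_of_not_isPrefix' hm hα,
            mul_zero, zero_mul]
      | add x y _ _ hx hy => exact hx.add_right hy
      | zero => exact Commute.zero_right _
      | mul x y _ _ hx hy => exact hx.mul_right hy
      | smul r x _ hx => exact hx.smul_right r
  tfae_have 2 → 1 := fun ⟨hn, hc⟩ γ hγ => by
    rw [KP.isStarNormal_iff α β hs] at hn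
    have h := hc _ (NonUnitalAlgebra.subset_adjoin R ⟨β.comp γ (hs.symm.trans hγ), rfl⟩)
    have hβ : IsPrefix β (β.comp γ (hs.symm.trans hγ)) := IsPrefix.comp _ _ _
    -- Conjugate `e_{βγ}` by `s_α s_{β*}`, move `e_{βγ}` to the front, and use `e_{βγ} e_α = e_{βγ}
    -- e_β = e_{βγ}`.
    calc path R (α.comp γ hγ) * ghost R (α.comp γ hγ)
        = path R α * ghost R β * (path R (β.comp γ (hs.symm.trans hγ)) *
            ghost R (β.comp γ (hs.symm.trans hγ))) * (path R β * ghost R α) := by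
          simp only [path_comp, ghost_comp, mul_assoc]
          rw [← mul_assoc (ghost R β) (path R β), ← mul_assoc (ghost R β) (path R β),
            ghost_mul_path_self, ← hs, p_mul_ghost, ← mul_assoc (p R α.source), hγ, p_mul_path]
      _ = path R (β.comp γ (hs.symm.trans hγ)) * (ghost R (β.comp γ (hs.symm.trans hγ)) *
            (path R α * (ghost R β * path R β) * ghost R α)) := by
          rw [h.eq]
          simp only [mul_assoc]
      _ = _ := by
          rw [ghost_mul_path_self, show p R β.source = p R α.source from congrArg _ hs.symm,
            path_mul_p, hn, ghost_mul_proj hβ]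
  tfae_have 1 → 3 := fun H x hx => by
    -- It suffices that each `β x(0, q)` is an initial segment of `αx`.
    refine InfPath.eq_prepend _ fun q => ?_
    have hq : ∀ n, α.source = (x.seg 0 n zero_le).target := fun n => hx.trans (x.range_eq_target n)
    -- The extra `deg β` makes this extension of `α x(0, q)` long enough to contain `β x(0, q)`.
    have h : IsPrefix (β.comp (x.seg 0 q zero_le) (hs.symm.trans (hq q)))
        (α.comp (x.seg 0 (q + Λ.deg β) zero_le) (hq (q + Λ.deg β))) := by
      refine isPrefix_of_proj_eq (H _ (hq q)) ?_ ?_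
      · obtain ⟨c, hc, e⟩ := x.seg_isPrefix (le_self_add : q ≤ q + Λ.deg β)
        exact ⟨c, hc, (Mor.comp_congr rfl e _).trans (Mor.comp_assoc _ _ _ _ _).symm⟩
      · rw [Λ.deg_comp, Λ.deg_comp, InfPath.deg_seg_zero, InfPath.deg_seg_zero, add_comm q]
        exact le_add_self
    rw [← InfPath.seg_prepend α x hx] at h
    refine IsPrefix.eq_of_deg_eq (InfPath.seg_isPrefix _ (le_self_add (b := Λ.deg α))) h ?_
    rw [Λ.deg_comp, InfPath.deg_seg_zero, InfPath.deg_seg_zero, add_comm]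
  tfae_finish
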